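/- Let $\mathbb K$ be $\mathbb R$ or $\mathbb C$. A pointed metric space is a metric space with a base point $0$ (for a normed space, the zero vector). $\mathrm{Lip}_0(X,Y)$ is the set of base-point preserving Lipschitz maps $X\to Y$, $\mathrm{Lip}(f)$ is the least Lipschitz constant of $f$, $X^\#=\mathrm{Lip}_0(X,\mathbb K)$ is a Banach space under $\mathrm{Lip}$, and $\mathcal F(X)\subseteq (X^\#)^*$ is the Lipschitz-free space, the closed linear span of the evaluations $\delta_X(x)\colon g\mapsto g(x)$, $x\in X$. **Lipschitz tensor products.** For a pointed metric space $X$ and a Banach space $E$, the space $X\boxtimes E$ is the linear span of the functionals $\delta_{(x,y)}\boxtimes e\colon f\mapsto\langle f(x)-f(y),e\rangle$ on $\mathrm{Lip}_0(X,E^*)$, where $x,y\in X$, $e\in E$. For $h\in\mathrm{Lip}_0(X,Y)$ and $T\in\mathcal L(E,F)$, $h\boxtimes T\colon X\boxtimes E\to Y\boxtimes F$ is the linear map with $\delta_{(x,y)}\boxtimes e\mapsto\delta_{(h(x),h(y))}\boxtimes Te$. For $u\in X\boxtimes E$ put $\pi(u)=\inf\{\sum_i d(x_i,y_i)\|e_i\|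 : u=\sum_i\delta_{(x_i,y_i)}\boxtimes e_i\}$ and $\varepsilon(u)=\sup\{|u(g\cdot\phi)| : \mathrm{Lip}(g)\le 1,\ \|\phi\|\le 1\}$, where $g\in X^\#$, $\phi\in E^*$ and $(g\cdot\phi)(x)=g(x)\phi$. A *generic Lipschitz cross-norm* $\alpha$ assigns to every pointed metric space $X$ and every Banach space $E$ a norm $\alpha(\cdot;X,E)$ on $X\boxtimes E$ such that $\alpha(\delta_{(x,y)}\boxtimes e)=d(x,y)\|e\|$, $\varepsilon\le\alpha\le\pi$, and $\alpha((h\boxtimes T)u)\le \mathrm{Lip}(h)\|T\|\alpha(u)$ for all $h\in \mathrm{Lip}_0(X,Y)$, $T\in\mathcal L(E,F)$ and $u\in X\boxtimes E$. It is *finitely generated* if $\alpha(u;X,E)=\inf\alpha(u;X_0,E_0)$ for all $u \in X\boxtimes E$, the infimum being over all finite $X_0\subseteq X$ with $0\in X_0$ and all finite-dimensional subspaces $E_0\subseteq E$ with $u\in X_0\boxtimes E_0$. The completion of $X\boxtimes E$ under $\alpha$ is denoted by $X\widehat\boxtimes_\alpha E$. **Ideals.** A *generic Lipschitz operator Banach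 ideal* $A$ assigns to every pointed metric space $X$ and every Banach space $E$ a linear subspace $A(X,E)$ of $\mathrm{Lip}_0(X,E)$ with a complete norm $\|\cdot\|_A\ge\mathrm{Lip}$ such that $g\cdot e\colon x\mapsto g(x)e$ is in $A(X,E)$ with $\|g\cdot e\|_A\le\mathrm{Lip}(g)\|e\|$ for all $g\in X^\#$, $e\in E$, and such that for $f\in A(X,E)$, $h\in\mathrm{Lip}_0(Z,X)$, $S\in\mathcal L(E,F)$ one has $Sfh\in A(Z,F)$ and $\|Sfh\|_A\le\|S\|\,\|f\|_A\,\mathrm{Lip}(h)$. It is *strong* if moreover for $f\in A(X,E)$, $h\in\mathrm{Lip}_0(Z,X)$ and $g\in\mathrm{Lip}_0(E,F)$ ($E,F$ Banach spaces) one has $gfh\in A(Z,F)$ and $\|gfh\|_A\le\mathrm{Lip}(g)\|f\|_A\mathrm{Lip}(h)$. For $f\in\mathrm{Lip}_0(X,E)$ let $\|f\|_{A^{\max}}\in[0,\infty]$ be the supremum of $\|Q_L\circ f|_Y\|_A$ over all finite $Y\subseteq X$ with $0\in Y$ and all closed finite-codimensional subspaces $L$ of $E$, with $Q_L\colon E\to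 E/L$ the quotient map; $A$ is *maximal* if for all $X$, $E$ and $f\in\mathrm{Lip}_0(X,E)$ one has $f\in A(X,E)$ if and only if $\|f\|_{A^{\max}}<\infty$, and then $\|f\|_A=\|f\|_{A^{\max}}$. $A$ and $\alpha$ are *associated* if, for every finite pointed metric space $X$ and every finite-dimensional Banach space $E$, a map $f\in\mathrm{Lip}_0(X,E^*)$ is in $A(X,E^*)$ if and only if there is $C\ge0$ with $|u(f)|\le C\alpha(u;X,E)$ for all $u\in X\boxtimes E$, and then $\|f\|_A$ is the least such $C$. A strong ideal $A$ is extended to maps between pointed metric spaces: $f\in\mathrm{Lip}_0(X,Y)$ is in $A(X,Y)$ if and only if $\delta_Y\circ f\in A(X,\mathcal F(Y))$, and then $\|f\|_A:=\|\delta_Y\circ f\|_A$. **Theorem.** Let $A$ be a strong and maximal generic Lipschitz operator Banach ideal, and let $\alpha$ be the finitely generated generic Lipschitz cross-norm associated to $A$. For any pointed metric spaces $X$, $Y$ and any $f\in\mathrm{Lip}_0(X,Y)$, the following are equivalent: 1. $f\in A(X,Y)$; 2. for every Banach space $G$, $f\boxtimes\mathrm{id}_G$ is continuous as a map $X\widehat\boxtimes_\alpha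 G\to Y\widehat\boxtimes_\pi G$ (that is, it extends to a continuous linear map between these completions); 3. $f\boxtimes\mathrm{id}_{Y^\#}$ is continuous as a map $X\widehat\boxtimes_\alpha Y^\#\to Y\widehat\boxtimes_\pi Y^\#$. In this case, for every Banach space $G$, $$\|f\|_A=\big\|f\boxtimes \mathrm{id}_{Y^\#}\colon X\widehat\boxtimes_\alpha Y^\#\to Y\widehat\boxtimes_\pi Y^\#\big\|\ \ge\ \big\|f\boxtimes\mathrm{id}_G\colon X\widehat\boxtimes_\alpha G\to Y\widehat\boxtimes_\pi G\big\|.$$ -/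

import Mathlib

universe u

noncomputable section

/-- For pointed metric spaces `X`, `Y` (the base point is the `0` given by the class `Zero`), the type
`Lip₀(X, Y)` of Lipschitz maps that preserve the base point. A normed space is a pointed metric
space with base point its zero vector. -/
structure Lip0 (X Y : Type*) [MetricSpace X] [Zero X] [MetricSpace Y] [Zero Y] where
  toFun : X → Y
  map_zero' : toFun 0 = 0
  lipschitz' : ∃ C : ℝ, 0 ≤ C ∧ ∀ x y, dist (toFun x) (toFun y) ≤ C * dist x y

namespace Lip0

section Metric

variable {X Y Z : Type*} [MetricSpace X] [Zero X] [MetricSpace Y] [Zero Y] [MetricSpace Z] [Zero Z]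

instance instFunLike : FunLike (Lip0 X Y) X Y where
  coe := Lip0.toFun
  coe_injective := by
    rintro ⟨f, _, _⟩ ⟨g, _, _⟩ h
    simpa using h

@[ext] theorem ext {f g : Lip0 X Y} (h : ∀ x, f x = g x) : f = g := DFunLike.ext _ _ h

@[simp] theorem map_zero (f : Lip0 X Y) : f 0 = 0 := f.map_zero'

@[simp] theorem mk_apply (f : X → Y) (h0 h1) (x : X) : (⟨f, h0, h1⟩ : Lip0 X Y) x = f x := rfl

/-- The least Lipschitz constant `Lip(f)`. -/
def lip (f : Lip0 X Y) : ℝ :=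
  sInf {C : ℝ | 0 ≤ C ∧ ∀ x y, dist (f x) (f y) ≤ C * dist x y}

theorem lip_nonneg (f : Lip0 X Y) : 0 ≤ f.lip := Real.sInf_nonneg fun _ h => h.1

theorem lip_le {f : Lip0 X Y} {C : ℝ} (hC : 0 ≤ C)
    (h : ∀ x y, dist (f x) (f y) ≤ C * dist x y) : f.lip ≤ C :=
  csInf_le ⟨0, fun _ h => h.1⟩ ⟨hC, h⟩

theorem dist_le (f : Lip0 X Y) (x y : X) : dist (f x) (f y) ≤ f.lip * dist x y := by
  rcases eq_or_ne x y with rfl | hxy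
  · simp
  · have hd : 0 < dist x y := dist_pos.2 hxy
    rw [← div_le_iff₀ hd]
    refine le_csInf f.lipschitz' ?_
    rintro C ⟨-, hC⟩
    rw [div_le_iff₀ hd]
    exact hC x y

/-- Composition `g ∘ f`. -/
def comp (g : Lip0 Y Z) (f : Lip0 X Y) : Lip0 X Z where
  toFun x := g (f x)
  map_zero' := by simp
  lipschitz' := by
    refine ⟨g.lip * f.lip, mul_nonneg g.lip_nonneg f.lip_nonneg, fun x y => ?_⟩
    calc dist (g (f x)) (g (f y)) ≤ g.lip * dist (f x) (f y) := g.dist_le _ _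
      _ ≤ g.lip * (f.lip * dist x y) :=
        mul_le_mul_of_nonneg_left (f.dist_le x y) g.lip_nonneg
      _ = _ := by ring

@[simp] theorem comp_apply (g : Lip0 Y Z) (f : Lip0 X Y) (x : X) : g.comp f x = g (f x) := rfl

end Metric

/-- The Lipschitz dual `X^# = Lip₀(X, 𝕜)`. -/
abbrev _root_.LipDual (𝕜 X : Type*) [RCLike 𝕜] [MetricSpace X] [Zero X] : Type _ := Lip0 X 𝕜

section Normed

variable {X E F : Type*} [MetricSpace X] [Zero X] [NormedAddCommGroup E] [NormedAddCommGroup F]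

theorem norm_sub_le (f : Lip0 X E) (x y : X) : ‖f x - f y‖ ≤ f.lip * dist x y := by
  simpa [dist_eq_norm] using f.dist_le x y

theorem norm_le (f : Lip0 X E) (x : X) : ‖f x‖ ≤ f.lip * dist x 0 := by
  simpa using f.norm_sub_le x 0

/-- A base-point preserving map into a normed group satisfying a Lipschitz estimate. -/
def mkNorm (f : X → E) (h0 : f 0 = 0) (C : ℝ) (hC : 0 ≤ C)
    (h : ∀ x y, ‖f x - f y‖ ≤ C * dist x y) : Lip0 X E :=
  ⟨f, h0, C, hC, fun x y => by simpa [dist_eq_norm] using h x y⟩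

@[simp] theorem mkNorm_apply (f : X → E) (h0 C hC h) (x : X) :
    (mkNorm f h0 C hC h : Lip0 X E) x = f x := rfl

instance : Zero (Lip0 X E) := ⟨mkNorm (fun _ => 0) rfl 0 le_rfl (by simp)⟩

instance : Add (Lip0 X E) :=
  ⟨fun f g => mkNorm (fun x => f x + g x) (by simp) (f.lip + g.lip)
    (add_nonneg f.lip_nonneg g.lip_nonneg) fun x y => by
      have h1 := f.norm_sub_le x y
      have h2 := g.norm_sub_le x y
      have h3 : f x + g x - (f y + g y) = (f x - f y) + (g x - g y) := by abel
      rw [h3, add_mul]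
      exact (norm_add_le _ _).trans (add_le_add h1 h2)⟩

instance : Neg (Lip0 X E) :=
  ⟨fun f => mkNorm (fun x => - f x) (by simp) f.lip f.lip_nonneg fun x y => by
      have h3 : - f x - - f y = -(f x - f y) := by abel
      rw [h3, norm_neg]
      exact f.norm_sub_le x y⟩

instance : Sub (Lip0 X E) :=
  ⟨fun f g => mkNorm (fun x => f x - g x) (by simp) (f.lip + g.lip)
    (add_nonneg f.lip_nonneg g.lip_nonneg) fun x y => by
      have h1 := f.norm_sub_le x y
      have h2 := g.norm_sub_le x y
      have h3 : f x - g x - (f y - g y) = (f x - f y) - (g x - g y) := by abel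
      rw [h3, add_mul]
      exact (_root_.norm_sub_le _ _).trans (add_le_add h1 h2)⟩

instance {𝕜 : Type*} [NormedField 𝕜] [NormedSpace 𝕜 E] : SMul 𝕜 (Lip0 X E) :=
  ⟨fun c f => mkNorm (fun x => c • f x) (by simp) (‖c‖ * f.lip)
    (mul_nonneg (norm_nonneg _) f.lip_nonneg) fun x y => by
      rw [← smul_sub, norm_smul, mul_assoc]
      exact mul_le_mul_of_nonneg_left (f.norm_sub_le x y) (norm_nonneg _)⟩

@[simp] theorem zero_apply (x : X) : (0 : Lip0 X E) x = 0 := rfl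
@[simp] theorem add_apply (f g : Lip0 X E) (x : X) : (f + g) x = f x + g x := rfl
@[simp] theorem neg_apply (f : Lip0 X E) (x : X) : (-f) x = -f x := rfl
@[simp] theorem sub_apply (f g : Lip0 X E) (x : X) : (f - g) x = f x - g x := rfl
@[simp] theorem smul_apply {𝕜 : Type*} [NormedField 𝕜] [NormedSpace 𝕜 E] (c : 𝕜)
    (f : Lip0 X E) (x : X) : (c • f) x = c • f x := rfl

instance : AddCommGroup (Lip0 X E) where
  add_assoc f g h := by ext x; simp [add_assoc]
  zero_add f := by ext x; simp
  add_zero f := by ext x; simp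
  add_comm f g := by ext x; simp [add_comm]
  neg_add_cancel f := by ext x; simp
  sub_eq_add_neg f g := by ext x; simp [sub_eq_add_neg]
  nsmul := nsmulRec
  zsmul := zsmulRec

instance {𝕜 : Type*} [NormedField 𝕜] [NormedSpace 𝕜 E] : Module 𝕜 (Lip0 X E) where
  one_smul f := by ext x; simp
  mul_smul a b f := by ext x; simp [mul_smul]
  smul_zero a := by ext x; simp
  smul_add a f g := by ext x; simp
  add_smul a b f := by ext x; simp [add_smul]
  zero_smul f := by ext x; simp

/-- `Lip₀(X, E)` carries the Lipschitz norm `Lip`. -/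
instance : NormedAddCommGroup (Lip0 X E) :=
  AddGroupNorm.toNormedAddCommGroup
    { toFun := lip
      map_zero' := le_antisymm (lip_le le_rfl (by simp)) (lip_nonneg _)
      add_le' := fun f g => lip_le (add_nonneg f.lip_nonneg g.lip_nonneg) fun x y => by
        have h3 : f x + g x - (f y + g y) = (f x - f y) + (g x - g y) := by abel
        rw [dist_eq_norm, add_apply, add_apply, h3, add_mul]
        exact (norm_add_le _ _).trans (add_le_add (f.norm_sub_le x y) (g.norm_sub_le x y))
      neg' := fun f => by
        simp only [lip, neg_apply, dist_neg_neg]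
      eq_zero_of_map_eq_zero' := fun f hf => by
        ext x
        have h := f.norm_le x
        rw [hf, zero_mul] at h
        simpa using h }

theorem norm_def (f : Lip0 X E) : ‖f‖ = f.lip := rfl

instance {𝕜 : Type*} [NormedField 𝕜] [NormedSpace 𝕜 E] : NormedSpace 𝕜 (Lip0 X E) where
  norm_smul_le c f := lip_le (mul_nonneg (norm_nonneg _) f.lip_nonneg) fun x y => by
    rw [dist_eq_norm, smul_apply, smul_apply, ← smul_sub, norm_smul, mul_assoc]
    exact mul_le_mul_of_nonneg_left (f.norm_sub_le x y) (norm_nonneg _)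

instance [CompleteSpace E] : CompleteSpace (Lip0 X E) := by
  refine Metric.complete_of_cauchySeq_tendsto fun v hv => ?_
  have hd : ∀ (f g : Lip0 X E) (x y : X),
      ‖(f x - f y) - (g x - g y)‖ ≤ dist f g * dist x y := fun f g x y => by
    have h := (f - g).norm_sub_le x y
    rw [dist_eq_norm, norm_def]
    have h3 : (f x - f y) - (g x - g y) = (f - g) x - (f - g) y := by
      simp only [sub_apply]; abel
    rw [h3]; exact h
  have hx : ∀ x, CauchySeq fun n => v n x := fun x => by
    rw [Metric.cauchySeq_iff'] at hv ⊢
    intro ε hε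
    obtain ⟨N, hN⟩ := hv (ε / (dist x 0 + 1)) (by positivity)
    refine ⟨N, fun n hn => ?_⟩
    have h1 := hd (v n) (v N) x 0
    have h2 := hN n hn
    rw [dist_eq_norm]
    simp only [map_zero, sub_zero] at h1
    have hpos : 0 < dist x 0 + 1 := by positivity
    calc ‖v n x - v N x‖ ≤ dist (v n) (v N) * dist x 0 := h1
      _ ≤ dist (v n) (v N) * (dist x 0 + 1) :=
        mul_le_mul_of_nonneg_left (by linarith) dist_nonneg
      _ < ε := by rwa [lt_div_iff₀ hpos] at h2
  choose g hg using fun x => cauchySeq_tendsto_of_complete (hx x)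
  have key : ∀ ε > 0, ∃ N, ∀ n ≥ N, ∀ x y,
      ‖(v n x - v n y) - (g x - g y)‖ ≤ ε * dist x y := by
    intro ε hε
    obtain ⟨N, hN⟩ := Metric.cauchySeq_iff.1 hv ε hε
    refine ⟨N, fun n hn x y => ?_⟩
    have ht : Filter.Tendsto (fun m => ‖(v n x - v n y) - (v m x - v m y)‖) Filter.atTop
        (nhds ‖(v n x - v n y) - (g x - g y)‖) :=
      (tendsto_const_nhds.sub ((hg x).sub (hg y))).norm
    refine le_of_tendsto ht (Filter.eventually_atTop.2 ⟨N, fun m hm => ?_⟩)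
    exact (hd _ _ x y).trans
      (mul_le_mul_of_nonneg_right (hN n hn m hm).le dist_nonneg)
  have hg0 : g 0 = 0 := by
    refine tendsto_nhds_unique (hg 0) ?_
    simp
  obtain ⟨N, hN⟩ := key 1 one_pos
  have hgl : ∀ x y, ‖g x - g y‖ ≤ ((v N).lip + 1) * dist x y := fun x y => by
    have h1 := hN N le_rfl x y
    have h2 := (v N).norm_sub_le x y
    have h3 := norm_sub_norm_le (g x - g y) (v N x - v N y)
    rw [norm_sub_rev (g x - g y)] at h3
    linarith [add_mul (v N).lip 1 (dist x y)]
  let G : Lip0 X E := mkNorm g hg0 ((v N).lip + 1) (add_nonneg (lip_nonneg _) zero_le_one) hgl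
  refine ⟨G, Metric.tendsto_atTop.2 fun ε hε => ?_⟩
  obtain ⟨M, hM⟩ := key (ε / 2) (half_pos hε)
  refine ⟨M, fun n hn => lt_of_le_of_lt ?_ (half_lt_self hε)⟩
  rw [dist_eq_norm]
  refine lip_le (half_pos hε).le fun x y => ?_
  rw [dist_eq_norm]
  have h3 : (v n - G) x - (v n - G) y = (v n x - v n y) - (g x - g y) := by
    simp only [sub_apply, G, mkNorm_apply]; abel
  rw [h3]
  exact hM n hn x y

instance instNormedAddCommGroupLipDual {𝕜 : Type*} [RCLike 𝕜] :
    NormedAddCommGroup (LipDual 𝕜 X) := inferInstance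

instance instNormedSpaceLipDual {𝕜 : Type*} [RCLike 𝕜] :
    NormedSpace 𝕜 (LipDual 𝕜 X) := inferInstance

variable {𝕜 : Type*} [RCLike 𝕜] [NormedSpace 𝕜 E] [NormedSpace 𝕜 F]

/-- A bounded linear operator, as a base-point preserving Lipschitz map. -/
def ofCLM (T : E →L[𝕜] F) : Lip0 E F :=
  mkNorm T (_root_.map_zero T) ‖T‖ (norm_nonneg _) fun x y => by
    rw [← map_sub, dist_eq_norm]; exact T.le_opNorm _

@[simp] theorem ofCLM_apply (T : E →L[𝕜] F) (e : E) : ofCLM T e = T e := rfl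

/-- The rank-one operator `g · e : x ↦ g(x) e`, for `g ∈ X^#` and `e ∈ E`. -/
def rankOne (g : LipDual 𝕜 X) (e : E) : Lip0 X E :=
  mkNorm (fun x => g x • e) (by simp) (g.lip * ‖e‖) (mul_nonneg g.lip_nonneg (norm_nonneg _))
    fun x y => by
      rw [← sub_smul, norm_smul, mul_right_comm]
      exact mul_le_mul_of_nonneg_right (g.norm_sub_le x y) (norm_nonneg _)

@[simp] theorem rankOne_apply (g : LipDual 𝕜 X) (e : E) (x : X) : rankOne g e x = g x • e := rfl

end Normed

end Lip0

/-! ### Lipschitz-free spaces -/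

section Free

variable (𝕜 : Type*) [RCLike 𝕜] (Y : Type*) [MetricSpace Y] [Zero Y]

/-- The evaluation functional at `y`, an element of the dual of `Y^# = Lip₀(Y, 𝕜)`. -/
def lipEval (y : Y) : StrongDual 𝕜 (LipDual 𝕜 Y) :=
  LinearMap.mkContinuous
    { toFun := fun g => g y
      map_add' := fun _ _ => rfl
      map_smul' := fun _ _ => rfl } (dist y 0) fun g => by
    have h := g.norm_le y
    rw [mul_comm] at h
    exact h

@[simp] theorem lipEval_apply (y : Y) (g : LipDual 𝕜 Y) : lipEval 𝕜 Y y g = g y := rfl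

/-- The closed linear span of the evaluation functionals in the dual of `Y^#`. -/
def freeSubmodule : Submodule 𝕜 (StrongDual 𝕜 (LipDual 𝕜 Y)) :=
  (Submodule.span 𝕜 (Set.range (lipEval 𝕜 Y))).topologicalClosure

/-- The Lipschitz-free Banach space `𝓕(Y)`. -/
def FreeSpace : Type _ := freeSubmodule 𝕜 Y

instance : NormedAddCommGroup (FreeSpace 𝕜 Y) :=
  inferInstanceAs (NormedAddCommGroup (freeSubmodule 𝕜 Y))

instance : NormedSpace 𝕜 (FreeSpace 𝕜 Y) :=
  inferInstanceAs (NormedSpace 𝕜 (freeSubmodule 𝕜 Y))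

instance : CompleteSpace (FreeSpace 𝕜 Y) :=
  (Submodule.isClosed_topologicalClosure
    (Submodule.span 𝕜 (Set.range (lipEval 𝕜 Y)))).completeSpace_coe

/-- The canonical embedding `δ_Y : Y → 𝓕(Y)`. -/
def freeEmb : Lip0 Y (FreeSpace 𝕜 Y) :=
  Lip0.mkNorm
    (fun y => ⟨lipEval 𝕜 Y y, Submodule.le_topologicalClosure _
      (Submodule.subset_span (Set.mem_range_self y))⟩)
    (by
      apply Subtype.ext
      change lipEval 𝕜 Y 0 = 0
      ext g
      simp) 1 zero_le_one fun x y => by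
      rw [one_mul]
      change ‖lipEval 𝕜 Y x - lipEval 𝕜 Y y‖ ≤ dist x y
      refine ContinuousLinearMap.opNorm_le_bound _ dist_nonneg fun g => ?_
      have h := g.norm_sub_le x y
      rw [mul_comm] at h
      exact h

end Free

/-! ### Lipschitz tensor products -/

section Tensor

variable (𝕜 : Type*) [RCLike 𝕜] (X E : Type*) [MetricSpace X] [Zero X] [NormedAddCommGroup E]
  [NormedSpace 𝕜 E]

variable {X E} in
/-- The functional `δ_(x,y) ⊠ e` on `Lip₀(X, E*)`, `f ↦ ⟨f x - f y, e⟩`. -/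
def elemTensor (x y : X) (e : E) : Module.Dual 𝕜 (Lip0 X (StrongDual 𝕜 E)) where
  toFun f := (f x - f y) e
  map_add' f g := by simp; ring
  map_smul' c f := by simp; ring

/-- The Lipschitz tensor product `X ⊠ E`: the linear span of the functionals `δ_(x,y) ⊠ e` in the
algebraic dual of `Lip₀(X, E*)`. -/
def lipTensor : Submodule 𝕜 (Module.Dual 𝕜 (Lip0 X (StrongDual 𝕜 E))) :=
  Submodule.span 𝕜 {φ | ∃ (x y : X) (e : E), φ = elemTensor 𝕜 x y e}

/-- The type of elements of `X ⊠ E`. -/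
abbrev LipTensor : Type _ := lipTensor 𝕜 X E

variable {X E} in
/-- `δ_(x,y) ⊠ e` as an element of `X ⊠ E`. -/
def LipTensor.mk (x y : X) (e : E) : LipTensor 𝕜 X E :=
  ⟨elemTensor 𝕜 x y e, Submodule.subset_span ⟨x, y, e, rfl⟩⟩

variable {𝕜 X E}

@[simp] theorem elemTensor_apply (x y : X) (e : E) (f : Lip0 X (StrongDual 𝕜 E)) :
    elemTensor 𝕜 x y e f = f x e - f y e := by simp [elemTensor]

@[simp] theorem LipTensor.mk_coe_apply (x y : X) (e : E) (f : Lip0 X (StrongDual 𝕜 E)) :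
    (LipTensor.mk 𝕜 x y e).1 f = f x e - f y e := elemTensor_apply x y e f

/-- `r` is the value `∑ d(xᵢ,yᵢ)‖eᵢ‖` of some representation `u = ∑ δ_(xᵢ,yᵢ) ⊠ eᵢ`. -/
def LipTensor.IsRepValue (u : LipTensor 𝕜 X E) (r : ℝ) : Prop :=
  ∃ (n : ℕ) (x y : Fin n → X) (e : Fin n → E),
    u = ∑ i, LipTensor.mk 𝕜 (x i) (y i) (e i) ∧ r = ∑ i, dist (x i) (y i) * ‖e i‖

/-- The Lipschitz projective norm `π`. -/
def LipTensor.projNorm (u : LipTensor 𝕜 X E) : ℝ := sInf {r | u.IsRepValue r}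

/-- The Lipschitz injective norm `ε`; if `u = ∑ δ_(xᵢ,yᵢ) ⊠ eᵢ` then
`u (g · φ) = ∑ (g xᵢ - g yᵢ) ⟨φ, eᵢ⟩`. -/
def LipTensor.injNorm (u : LipTensor 𝕜 X E) : ℝ :=
  sSup {r | ∃ (g : LipDual 𝕜 X) (φ : StrongDual 𝕜 E), g.lip ≤ 1 ∧ ‖φ‖ ≤ 1 ∧
    r = ‖u.1 (Lip0.rankOne g φ)‖}

section Map

variable {Y F : Type*} [MetricSpace Y] [Zero Y] [NormedAddCommGroup F] [NormedSpace 𝕜 F]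

/-- The linear map `g ↦ T* ∘ g ∘ h` from `Lip₀(Y, F*)` to `Lip₀(X, E*)`. -/
def Lip0.pullback (h : Lip0 X Y) (T : E →L[𝕜] F) :
    Lip0 Y (StrongDual 𝕜 F) →ₗ[𝕜] Lip0 X (StrongDual 𝕜 E) where
  toFun g := Lip0.mkNorm (fun x => (g (h x)).comp T) (by simp) (g.lip * h.lip * ‖T‖)
    (by have := g.lip_nonneg; have := h.lip_nonneg; positivity) fun x y => by
      have h1 : ((g (h x)).comp T - (g (h y)).comp T) = (g (h x) - g (h y)).comp T := by
        ext; simp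
      have h2 : ‖g (h x) - g (h y)‖ ≤ g.lip * h.lip * dist x y := by
        have := (g.comp h).lip_nonneg
        calc _ ≤ g.lip * dist (h x) (h y) := g.norm_sub_le _ _
          _ ≤ g.lip * (h.lip * dist x y) :=
            mul_le_mul_of_nonneg_left (h.dist_le x y) g.lip_nonneg
          _ = _ := by ring
      rw [h1]
      calc _ ≤ ‖g (h x) - g (h y)‖ * ‖T‖ := ContinuousLinearMap.opNorm_comp_le _ _
        _ ≤ (g.lip * h.lip * dist x y) * ‖T‖ := mul_le_mul_of_nonneg_right h2 (norm_nonneg _)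
        _ = _ := by ring
  map_add' f g := by ext; simp
  map_smul' c f := by ext; simp

@[simp] theorem Lip0.pullback_apply (h : Lip0 X Y) (T : E →L[𝕜] F) (g : Lip0 Y (StrongDual 𝕜 F))
    (x : X) (e : E) : Lip0.pullback h T g x e = g (h x) (T e) := rfl

theorem elemTensor_comp_pullback (h : Lip0 X Y) (T : E →L[𝕜] F) (x y : X) (e : E) :
    (Lip0.pullback h T).dualMap (elemTensor 𝕜 x y e) = elemTensor 𝕜 (h x) (h y) (T e) := by
  ext g; simp

/-- The linear map `h ⊠ T : X ⊠ E → Y ⊠ F`, determined by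
`δ_(x,y) ⊠ e ↦ δ_(h x, h y) ⊠ T e` (see `LipTensor.map_mk`). -/
def LipTensor.map (h : Lip0 X Y) (T : E →L[𝕜] F) : LipTensor 𝕜 X E →ₗ[𝕜] LipTensor 𝕜 Y F :=
  (Lip0.pullback h T).dualMap.restrict (p := lipTensor 𝕜 X E) (q := lipTensor 𝕜 Y F) <| by
    intro u hu
    induction hu using Submodule.span_induction with
    | mem φ hφ =>
      obtain ⟨x, y, e, rfl⟩ := hφ
      rw [elemTensor_comp_pullback]
      exact (LipTensor.mk 𝕜 (h x) (h y) (T e)).2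
    | zero => rw [_root_.map_zero]; exact Submodule.zero_mem _
    | add a b _ _ ha hb => rw [map_add]; exact Submodule.add_mem _ ha hb
    | smul c a _ ha => rw [map_smul]; exact Submodule.smul_mem _ c ha

@[simp] theorem LipTensor.map_mk (h : Lip0 X Y) (T : E →L[𝕜] F) (x y : X) (e : E) :
    LipTensor.map h T (LipTensor.mk 𝕜 x y e) = LipTensor.mk 𝕜 (h x) (h y) (T e) :=
  Subtype.ext (elemTensor_comp_pullback h T x y e)

end Map

variable (𝕜 X E) in
/-- A Lipschitz cross-norm on `X ⊠ E`: a norm with `α(δ_(x,y) ⊠ e) = d(x,y) ‖e‖`. -/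
structure LipCrossNorm where
  toSeminorm : Seminorm 𝕜 (LipTensor 𝕜 X E)
  eq_zero' : ∀ u, toSeminorm u = 0 → u = 0
  cross' : ∀ (x y : X) (e : E), toSeminorm (LipTensor.mk 𝕜 x y e) = dist x y * ‖e‖

instance : CoeFun (LipCrossNorm 𝕜 X E) fun _ => LipTensor 𝕜 X E → ℝ := ⟨fun α u => α.toSeminorm u⟩

/-! The projective norm is a Lipschitz cross-norm. -/

theorem LipTensor.exists_repValue (u : LipTensor 𝕜 X E) : ∃ r, u.IsRepValue r := by
  obtain ⟨u, hu⟩ := u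
  induction hu using Submodule.span_induction with
  | mem φ hφ =>
    obtain ⟨x, y, e, rfl⟩ := hφ
    exact ⟨_, 1, fun _ => x, fun _ => y, fun _ => e, by simp [LipTensor.mk], rfl⟩
  | zero => exact ⟨_, 0, fun i => i.elim0, fun i => i.elim0, fun i => i.elim0, by simp; rfl, rfl⟩
  | add a b ha hb iha ihb =>
    obtain ⟨-, n, x, y, e, h, -⟩ := iha
    obtain ⟨-, m, x', y', e', h', -⟩ := ihb
    refine ⟨_, n + m, Fin.append x x', Fin.append y y', Fin.append e e', ?_, rfl⟩
    rw [Fin.sum_univ_add]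
    simp only [Fin.append_left, Fin.append_right, ← h, ← h']
    rfl
  | smul c a ha iha =>
    obtain ⟨-, n, x, y, e, h, -⟩ := iha
    refine ⟨_, n, x, y, fun i => c • e i, ?_, rfl⟩
    have h2 : (⟨c • a, Submodule.smul_mem _ c ha⟩ : LipTensor 𝕜 X E) = c • ⟨a, ha⟩ := rfl
    rw [h2, h, Finset.smul_sum]
    refine Finset.sum_congr rfl fun i _ => Subtype.ext ?_
    ext f
    simp [mul_sub]

theorem LipTensor.IsRepValue.nonneg {u : LipTensor 𝕜 X E} {r : ℝ} (h : u.IsRepValue r) : 0 ≤ r := by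
  obtain ⟨n, x, y, e, -, rfl⟩ := h
  positivity

theorem LipTensor.projNorm_nonneg (u : LipTensor 𝕜 X E) : 0 ≤ u.projNorm :=
  Real.sInf_nonneg fun _ h => h.nonneg

theorem LipTensor.projNorm_le {u : LipTensor 𝕜 X E} {r : ℝ} (h : u.IsRepValue r) :
    u.projNorm ≤ r :=
  csInf_le ⟨0, fun _ h => h.nonneg⟩ h

theorem LipTensor.norm_apply_le_projNorm (u : LipTensor 𝕜 X E) (f : Lip0 X (StrongDual 𝕜 E)) :
    ‖u.1 f‖ ≤ f.lip * u.projNorm := by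
  have h1 : ∀ r, u.IsRepValue r → ‖u.1 f‖ ≤ f.lip * r := by
    rintro r ⟨n, x, y, e, rfl, rfl⟩
    rw [Finset.mul_sum, AddSubmonoidClass.coe_finsetSum, LinearMap.sum_apply]
    refine (norm_sum_le _ _).trans (Finset.sum_le_sum fun i _ => ?_)
    rw [LipTensor.mk_coe_apply, ← sub_apply, ← mul_assoc]
    exact (ContinuousLinearMap.le_opNorm _ _).trans
      (mul_le_mul_of_nonneg_right (f.norm_sub_le _ _) (norm_nonneg _))
  rcases f.lip_nonneg.eq_or_lt with h | h
  · obtain ⟨r, hr⟩ := u.exists_repValue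
    simpa [← h] using h1 r hr
  · rw [← div_le_iff₀' h]
    refine le_csInf u.exists_repValue fun r hr => ?_
    rw [div_le_iff₀' h]
    exact h1 r hr

theorem LipTensor.projNorm_add_le (u v : LipTensor 𝕜 X E) :
    (u + v).projNorm ≤ u.projNorm + v.projNorm := by
  refine le_of_forall_pos_le_add fun ε hε => ?_
  obtain ⟨r, hr, hr'⟩ := exists_lt_of_csInf_lt (s := {r | u.IsRepValue r}) u.exists_repValue
    (show u.projNorm < u.projNorm + ε / 2 by linarith)
  obtain ⟨s, hs, hs'⟩ := exists_lt_of_csInf_lt (s := {r | v.IsRepValue r}) v.exists_repValue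
    (show v.projNorm < v.projNorm + ε / 2 by linarith)
  have h : (u + v).IsRepValue (r + s) := by
    obtain ⟨n, x, y, e, h, rfl⟩ := hr
    obtain ⟨m, x', y', e', h', rfl⟩ := hs
    refine ⟨n + m, Fin.append x x', Fin.append y y', Fin.append e e', ?_, ?_⟩ <;>
      rw [Fin.sum_univ_add] <;> simp only [Fin.append_left, Fin.append_right, ← h, ← h']
  linarith [LipTensor.projNorm_le h]

theorem LipTensor.projNorm_smul_le (c : 𝕜) (u : LipTensor 𝕜 X E) :
    (c • u).projNorm ≤ ‖c‖ * u.projNorm := by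
  have h1 : ∀ r, u.IsRepValue r → (c • u).projNorm ≤ ‖c‖ * r := by
    rintro r ⟨n, x, y, e, rfl, rfl⟩
    refine LipTensor.projNorm_le ⟨n, x, y, fun i => c • e i, ?_, ?_⟩
    · rw [Finset.smul_sum]
      refine Finset.sum_congr rfl fun i _ => Subtype.ext ?_
      ext f
      simp [mul_sub]
    · rw [Finset.mul_sum]
      refine Finset.sum_congr rfl fun i _ => ?_
      rw [norm_smul]; ring
  rcases (norm_nonneg c).eq_or_lt with h | h
  · obtain ⟨r, hr⟩ := u.exists_repValue
    simpa [← h] using h1 r hr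
  · rw [← div_le_iff₀' h]
    refine le_csInf u.exists_repValue fun r hr => ?_
    rw [div_le_iff₀' h]
    exact h1 r hr

theorem LipTensor.projNorm_mk (x y : X) (e : E) :
    (LipTensor.mk 𝕜 x y e).projNorm = dist x y * ‖e‖ := by
  refine le_antisymm
    (LipTensor.projNorm_le ⟨1, fun _ => x, fun _ => y, fun _ => e, by simp, by simp⟩) ?_
  obtain ⟨φ, hφ, hφe⟩ := exists_dual_vector'' 𝕜 e
  let g : LipDual 𝕜 X := Lip0.mkNorm (fun z => ((dist z y - dist 0 y : ℝ) : 𝕜)) (by simp) 1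
    zero_le_one fun z w => by
      rw [← RCLike.ofReal_sub, RCLike.norm_ofReal, one_mul]
      have h3 : dist z y - dist 0 y - (dist w y - dist 0 y) = dist z y - dist w y := by ring
      rw [h3]
      exact abs_dist_sub_le z w y
  have hg : g.lip ≤ 1 := Lip0.lip_le zero_le_one fun z w => by
    rw [dist_eq_norm, one_mul]
    simp only [g, Lip0.mkNorm_apply, ← RCLike.ofReal_sub, RCLike.norm_ofReal]
    have h3 : dist z y - dist 0 y - (dist w y - dist 0 y) = dist z y - dist w y := by ring
    rw [h3]
    exact abs_dist_sub_le z w y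
  have hl : (Lip0.rankOne g φ).lip ≤ 1 := Lip0.lip_le zero_le_one fun z w => by
    rw [dist_eq_norm, Lip0.rankOne_apply, Lip0.rankOne_apply, ← sub_smul, norm_smul]
    calc _ ≤ ‖g z - g w‖ * 1 := mul_le_mul_of_nonneg_left hφ (norm_nonneg _)
      _ ≤ g.lip * dist z w := by rw [mul_one]; exact g.norm_sub_le z w
      _ ≤ _ := mul_le_mul_of_nonneg_right hg dist_nonneg
  have h := LipTensor.norm_apply_le_projNorm (LipTensor.mk 𝕜 x y e) (Lip0.rankOne g φ)
  have h2 : (LipTensor.mk 𝕜 x y e).1 (Lip0.rankOne g φ) = ((dist x y * ‖e‖ : ℝ) : 𝕜) := by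
    rw [LipTensor.mk_coe_apply]
    simp only [Lip0.rankOne_apply, smul_apply, hφe, smul_eq_mul, g,
      Lip0.mkNorm_apply, dist_self]
    push_cast
    ring
  rw [h2, RCLike.norm_ofReal, abs_of_nonneg (by positivity)] at h
  refine h.trans ?_
  calc _ ≤ 1 * _ := mul_le_mul_of_nonneg_right hl (LipTensor.projNorm_nonneg _)
    _ = _ := one_mul _

variable (𝕜 X E) in
/-- The Lipschitz projective norm `π` as a Lipschitz cross-norm on `X ⊠ E`. -/
def LipCrossNorm.proj : LipCrossNorm 𝕜 X E where
  toSeminorm := Seminorm.ofSMulLE LipTensor.projNorm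
    (le_antisymm (LipTensor.projNorm_le ⟨0, fun i => i.elim0, fun i => i.elim0, fun i => i.elim0,
      by simp, by simp⟩) (LipTensor.projNorm_nonneg _))
    LipTensor.projNorm_add_le LipTensor.projNorm_smul_le
  eq_zero' u hu := by
    refine Subtype.ext (LinearMap.ext fun f => ?_)
    have h := LipTensor.norm_apply_le_projNorm u f
    have hu' : u.projNorm = 0 := hu
    rw [hu', mul_zero] at h
    simpa using h
  cross' := LipTensor.projNorm_mk

/-- The normed space `X ⊠_α E`. -/
def LipTensorNormed (_ : LipCrossNorm 𝕜 X E) : Type _ := LipTensor 𝕜 X E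

namespace LipTensorNormed

variable (α : LipCrossNorm 𝕜 X E)

instance : AddCommGroup (LipTensorNormed α) := inferInstanceAs (AddCommGroup (LipTensor 𝕜 X E))

instance : Module 𝕜 (LipTensorNormed α) := inferInstanceAs (Module 𝕜 (LipTensor 𝕜 X E))

/-- The identity map from `X ⊠ E` to `X ⊠_α E`. -/
def of : LipTensor 𝕜 X E ≃ₗ[𝕜] LipTensorNormed α := LinearEquiv.refl 𝕜 (LipTensor 𝕜 X E)

instance : NormedAddCommGroup (LipTensorNormed α) :=
  AddGroupNorm.toNormedAddCommGroup
    { toFun := fun u => α ((of α).symm u)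
      map_zero' := by simp
      add_le' := fun u v => by rw [map_add]; exact map_add_le_add _ _ _
      neg' := fun u => by rw [map_neg]; exact map_neg_eq_map _ _
      eq_zero_of_map_eq_zero' := fun u hu => α.eq_zero' u hu }

theorem norm_of (u : LipTensor 𝕜 X E) : ‖of α u‖ = α u := rfl

instance : NormedSpace 𝕜 (LipTensorNormed α) where
  norm_smul_le c u := (map_smul_eq_mul α.toSeminorm c ((of α).symm u)).le

end LipTensorNormed

/-- The completion of `X ⊠_α E`. -/
abbrev LipTensorCompl (α : LipCrossNorm 𝕜 X E) : Type _ :=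
  UniformSpace.Completion (LipTensorNormed α)

/-- The canonical map from `X ⊠ E` into the completion of `X ⊠_α E`. -/
def LipTensorCompl.of (α : LipCrossNorm 𝕜 X E) (u : LipTensor 𝕜 X E) :
    LipTensorCompl α :=
  ((LipTensorNormed.of α u : LipTensorNormed α) : UniformSpace.Completion (LipTensorNormed α))

/-- `T` is the continuous linear extension to the completions of `h ⊠ S : X ⊠ E → Y ⊠ F`.
Such a `T` is unique; it exists if and only if `h ⊠ S` is continuous for the norms `α`, `β`, and
then its norm is the norm of `h ⊠ S`. -/
def IsTensorExtension {Y F : Type*} [MetricSpace Y] [Zero Y] [NormedAddCommGroup F]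
    [NormedSpace 𝕜 F] (α : LipCrossNorm 𝕜 X E) (β : LipCrossNorm 𝕜 Y F) (h : Lip0 X Y)
    (S : E →L[𝕜] F) (T : LipTensorCompl α →L[𝕜] LipTensorCompl β) : Prop :=
  ∀ u : LipTensor 𝕜 X E, T (LipTensorCompl.of α u) = LipTensorCompl.of β (LipTensor.map h S u)

/-- `C ≥ 0` satisfies `|u(f)| ≤ C α(u)` for all `u ∈ X ⊠ E`. -/
def LipCrossNorm.IsLipBound (α : LipCrossNorm 𝕜 X E) (f : Lip0 X (StrongDual 𝕜 E)) (C : ℝ) : Prop :=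
  0 ≤ C ∧ ∀ u : LipTensor 𝕜 X E, ‖u.1 f‖ ≤ C * α u

/-- The `α`-Lipschitz norm `Lip_α(f)` (meaningful if some `C` is a bound). -/
def LipCrossNorm.lipNorm (α : LipCrossNorm 𝕜 X E) (f : Lip0 X (StrongDual 𝕜 E)) : ℝ :=
  sInf {C | α.IsLipBound f C}

end Tensor

/-! ### Finite pointed subsets, finite-dimensional and finite-codimensional subspaces -/

/-- `MFIN(X)`: the finite subsets of `X` that contain the base point. -/
structure MFin (X : Type*) [Zero X] where
  carrier : Set X
  finite' : carrier.Finite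
  zero_mem' : (0 : X) ∈ carrier

namespace MFin

variable {X : Type*} [MetricSpace X] [Zero X]

instance : CoeSort (MFin X) (Type _) := ⟨fun Y => Y.carrier⟩

instance (Y : MFin X) : Zero Y := ⟨⟨0, Y.zero_mem'⟩⟩

instance (Y : MFin X) : Finite Y := Y.finite'

/-- The inclusion `I : Y → X`. -/
def incl (Y : MFin X) : Lip0 Y X where
  toFun y := y
  map_zero' := rfl
  lipschitz' := ⟨1, zero_le_one, fun x y => by rw [one_mul]; rfl⟩

end MFin

/-- `FIN(E)`: the finite-dimensional subspaces of `E`. -/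
structure FinSub (𝕜 E : Type*) [RCLike 𝕜] [NormedAddCommGroup E] [NormedSpace 𝕜 E] where
  carrier : Submodule 𝕜 E
  finite' : FiniteDimensional 𝕜 carrier

namespace FinSub

variable {𝕜 E : Type*} [RCLike 𝕜] [NormedAddCommGroup E] [NormedSpace 𝕜 E]

instance : CoeSort (FinSub 𝕜 E) (Type _) := ⟨fun M => M.carrier⟩

instance (M : FinSub 𝕜 E) : FiniteDimensional 𝕜 M := M.finite'

instance (M : FinSub 𝕜 E) : CompleteSpace M := FiniteDimensional.complete 𝕜 M

end FinSub

/-- `COFIN(E)`: the closed subspaces of `E` of finite codimension. -/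
structure CofinSub (𝕜 E : Type*) [RCLike 𝕜] [NormedAddCommGroup E] [NormedSpace 𝕜 E] where
  carrier : Submodule 𝕜 E
  closed' : IsClosed (carrier : Set E)
  finite' : FiniteDimensional 𝕜 (E ⧸ carrier)

namespace CofinSub

variable {𝕜 E : Type*} [RCLike 𝕜] [NormedAddCommGroup E] [NormedSpace 𝕜 E]

instance (L : CofinSub 𝕜 E) : IsClosed (L.carrier : Set E) := L.closed'

instance (L : CofinSub 𝕜 E) : FiniteDimensional 𝕜 (E ⧸ L.carrier) := L.finite'

/-- The canonical projection `Q : E → E/L`. -/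
def proj (L : CofinSub 𝕜 E) : E →L[𝕜] E ⧸ L.carrier := L.carrier.mkQL

end CofinSub

/-! ### Generic Lipschitz cross-norms and generic Lipschitz operator Banach ideals -/

/-- A generic Lipschitz cross-norm: a dualizable Lipschitz cross-norm on `X ⊠ E` for all pointed
metric spaces `X` and Banach spaces `E`, with the metric mapping property. -/
structure GenericLipCrossNorm (𝕜 : Type) [RCLike 𝕜] where
  norm : ∀ (X : Type u) [MetricSpace X] [Zero X] (E : Type u) [NormedAddCommGroup E]
    [NormedSpace 𝕜 E] [CompleteSpace E], LipCrossNorm 𝕜 X E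
  injNorm_le : ∀ (X : Type u) [MetricSpace X] [Zero X] (E : Type u) [NormedAddCommGroup E]
    [NormedSpace 𝕜 E] [CompleteSpace E] (u : LipTensor 𝕜 X E), u.injNorm ≤ norm X E u
  le_projNorm : ∀ (X : Type u) [MetricSpace X] [Zero X] (E : Type u) [NormedAddCommGroup E]
    [NormedSpace 𝕜 E] [CompleteSpace E] (u : LipTensor 𝕜 X E), norm X E u ≤ u.projNorm
  metric_mapping : ∀ (X Y : Type u) [MetricSpace X] [Zero X] [MetricSpace Y] [Zero Y]
    (E F : Type u) [NormedAddCommGroup E] [NormedSpace 𝕜 E] [CompleteSpace E]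
    [NormedAddCommGroup F] [NormedSpace 𝕜 F] [CompleteSpace F]
    (h : Lip0 X Y) (T : E →L[𝕜] F) (u : LipTensor 𝕜 X E),
    norm Y F (LipTensor.map h T u) ≤ h.lip * ‖T‖ * norm X E u

/-- `α(u; X, E)` is the infimum of `α(u; X₀, E₀)` over the finite pointed `X₀ ⊆ X` and the
finite-dimensional `E₀ ⊆ E` with `u ∈ X₀ ⊠ E₀`. -/
def GenericLipCrossNorm.FinitelyGenerated {𝕜 : Type} [RCLike 𝕜]
    (α : GenericLipCrossNorm.{u} 𝕜) : Prop :=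
  ∀ (X : Type u) [MetricSpace X] [Zero X] (E : Type u) [NormedAddCommGroup E] [NormedSpace 𝕜 E]
    [CompleteSpace E] (u : LipTensor 𝕜 X E),
    α.norm X E u = sInf {r : ℝ | ∃ (X₀ : MFin X) (E₀ : FinSub 𝕜 E) (u₀ : LipTensor 𝕜 X₀ E₀),
      LipTensor.map X₀.incl E₀.carrier.subtypeL u₀ = u ∧ r = α.norm X₀ E₀ u₀}

/-- A generic Lipschitz operator Banach ideal. -/
structure GenericLipIdeal (𝕜 : Type) [RCLike 𝕜] where
  carrier : ∀ (X : Type u) [MetricSpace X] [Zero X] (E : Type u) [NormedAddCommGroup E]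
    [NormedSpace 𝕜 E] [CompleteSpace E], Submodule 𝕜 (Lip0 X E)
  norm : ∀ (X : Type u) [MetricSpace X] [Zero X] (E : Type u) [NormedAddCommGroup E]
    [NormedSpace 𝕜 E] [CompleteSpace E], Seminorm 𝕜 (carrier X E)
  eq_zero : ∀ (X : Type u) [MetricSpace X] [Zero X] (E : Type u) [NormedAddCommGroup E]
    [NormedSpace 𝕜 E] [CompleteSpace E] (f : carrier X E), norm X E f = 0 → f = 0
  rankOne_mem : ∀ (X : Type u) [MetricSpace X] [Zero X] (E : Type u) [NormedAddCommGroup E]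
    [NormedSpace 𝕜 E] [CompleteSpace E] (g : LipDual 𝕜 X) (e : E), Lip0.rankOne g e ∈ carrier X E
  norm_rankOne_le : ∀ (X : Type u) [MetricSpace X] [Zero X] (E : Type u) [NormedAddCommGroup E]
    [NormedSpace 𝕜 E] [CompleteSpace E] (g : LipDual 𝕜 X) (e : E),
    norm X E ⟨Lip0.rankOne g e, rankOne_mem X E g e⟩ ≤ g.lip * ‖e‖
  lip_le_norm : ∀ (X : Type u) [MetricSpace X] [Zero X] (E : Type u) [NormedAddCommGroup E]
    [NormedSpace 𝕜 E] [CompleteSpace E] (f : carrier X E), f.1.lip ≤ norm X E f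
  complete : ∀ (X : Type u) [MetricSpace X] [Zero X] (E : Type u) [NormedAddCommGroup E]
    [NormedSpace 𝕜 E] [CompleteSpace E] (s : ℕ → carrier X E),
    (∀ ε > 0, ∃ N, ∀ m ≥ N, ∀ n ≥ N, norm X E (s m - s n) < ε) →
      ∃ f : carrier X E, Filter.Tendsto (fun n => norm X E (s n - f)) Filter.atTop (nhds 0)
  comp_mem : ∀ (Z X : Type u) [MetricSpace Z] [Zero Z] [MetricSpace X] [Zero X]
    (E F : Type u) [NormedAddCommGroup E] [NormedSpace 𝕜 E] [CompleteSpace E]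
    [NormedAddCommGroup F] [NormedSpace 𝕜 F] [CompleteSpace F]
    (S : E →L[𝕜] F) (f : carrier X E) (h : Lip0 Z X),
    (Lip0.ofCLM S).comp (f.1.comp h) ∈ carrier Z F
  norm_comp_le : ∀ (Z X : Type u) [MetricSpace Z] [Zero Z] [MetricSpace X] [Zero X]
    (E F : Type u) [NormedAddCommGroup E] [NormedSpace 𝕜 E] [CompleteSpace E]
    [NormedAddCommGroup F] [NormedSpace 𝕜 F] [CompleteSpace F]
    (S : E →L[𝕜] F) (f : carrier X E) (h : Lip0 Z X),
    norm Z F ⟨(Lip0.ofCLM S).comp (f.1.comp h), comp_mem Z X E F S f h⟩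
      ≤ ‖S‖ * norm X E f * h.lip

namespace GenericLipIdeal

variable {𝕜 : Type} [RCLike 𝕜]

open Classical in
/-- `‖f‖_A` as an extended number: it is `∞` if `f` does not belong to `A(X, E)`. -/
def extNorm (A : GenericLipIdeal.{u} 𝕜) {X : Type u} [MetricSpace X] [Zero X]
    {E : Type u} [NormedAddCommGroup E] [NormedSpace 𝕜 E] [CompleteSpace E] (f : Lip0 X E) :
    ENNReal :=
  if hf : f ∈ A.carrier X E then ENNReal.ofReal (A.norm X E ⟨f, hf⟩) else ⊤

/-- `‖f‖_{A^max}`: the supremum of `‖Q ∘ f ∘ I‖_A`, `I : Y → X` the inclusion of a finite pointed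
subset and `Q : E → E/L` the projection for a closed subspace `L` of finite codimension. -/
def maxNorm (A : GenericLipIdeal.{u} 𝕜) {X : Type u} [MetricSpace X] [Zero X]
    {E : Type u} [NormedAddCommGroup E] [NormedSpace 𝕜 E] [CompleteSpace E] (f : Lip0 X E) :
    ENNReal :=
  ⨆ (Y : MFin X) (L : CofinSub 𝕜 E), A.extNorm ((Lip0.ofCLM L.proj).comp (f.comp Y.incl))

/-- `A` coincides with its maximal hull `A^max = {f | ‖f‖_{A^max} < ∞}`, with equal norms. -/
def IsMaximal (A : GenericLipIdeal.{u} 𝕜) : Prop :=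
  ∀ (X : Type u) [MetricSpace X] [Zero X] (E : Type u) [NormedAddCommGroup E] [NormedSpace 𝕜 E]
    [CompleteSpace E] (f : Lip0 X E),
    (f ∈ A.carrier X E ↔ A.maxNorm f < ⊤) ∧
      ∀ hf : f ∈ A.carrier X E, ENNReal.ofReal (A.norm X E ⟨f, hf⟩) = A.maxNorm f

/-- The ideal property of a strong ideal, for compositions `g ∘ f ∘ h` with Lipschitz `g`. -/
def IsStrong (A : GenericLipIdeal.{u} 𝕜) : Prop :=
  ∀ (Z X : Type u) [MetricSpace Z] [Zero Z] [MetricSpace X] [Zero X]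
    (E F : Type u) [NormedAddCommGroup E] [NormedSpace 𝕜 E] [CompleteSpace E]
    [NormedAddCommGroup F] [NormedSpace 𝕜 F] [CompleteSpace F]
    (g : Lip0 E F) (f : A.carrier X E) (h : Lip0 Z X),
    ∃ hm : g.comp (f.1.comp h) ∈ A.carrier Z F,
      A.norm Z F ⟨g.comp (f.1.comp h), hm⟩ ≤ g.lip * A.norm X E f * h.lip

/-- `A ∼ α`: for finite `X` and finite-dimensional `E`, `A(X, E*) = Lip_α(X, E*)` isometrically. -/
def IsAssociated (A : GenericLipIdeal.{u} 𝕜) (α : GenericLipCrossNorm.{u} 𝕜) : Prop :=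
  ∀ (X : Type u) [MetricSpace X] [Zero X] [Finite X] (E : Type u) [NormedAddCommGroup E]
    [NormedSpace 𝕜 E] [CompleteSpace E] [FiniteDimensional 𝕜 E] (f : Lip0 X (StrongDual 𝕜 E)),
    (f ∈ A.carrier X (StrongDual 𝕜 E) ↔ ∃ C, (α.norm X E).IsLipBound f C) ∧
      ∀ hf : f ∈ A.carrier X (StrongDual 𝕜 E),
        A.norm X (StrongDual 𝕜 E) ⟨f, hf⟩ = (α.norm X E).lipNorm f

/-- `f ∈ A(X, Y)` for a map between pointed metric spaces: `δ_Y ∘ f ∈ A(X, 𝓕(Y))`. -/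
def MemMetric (A : GenericLipIdeal.{u} 𝕜) {X Y : Type u} [MetricSpace X] [Zero X] [MetricSpace Y]
    [Zero Y] (f : Lip0 X Y) : Prop :=
  (freeEmb 𝕜 Y).comp f ∈ A.carrier X (FreeSpace 𝕜 Y)

/-- `‖f‖_A = ‖δ_Y ∘ f‖_A` for `f ∈ A(X, Y)`, `X` and `Y` pointed metric spaces. -/
def metricNorm (A : GenericLipIdeal.{u} 𝕜) {X Y : Type u} [MetricSpace X] [Zero X]
    [MetricSpace Y] [Zero Y] (f : Lip0 X Y) (hf : A.MemMetric f) : ℝ :=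
  A.norm X (FreeSpace 𝕜 Y) ⟨(freeEmb 𝕜 Y).comp f, hf⟩

end GenericLipIdeal

end

/-! Both implications rest on duality. The bounded functionals on `Y ⊠_π G` are the evaluations at
maps `g ∈ Lip₀(Y, G*)` (`LipTensor.exists_eq_evalAt`), so by Hahn-Banach `π(v)` is bounded by the
supremum of `|v(g)|` over `Lip(g) ≤ 1` (`LipTensor.projNorm_le_of_forall`). Moreover `(f ⊠ id)u`
evaluated at `g` is `u(g ∘ f)`.

If `f ∈ A`, each such `g` factors through `δ_Y` by a linear operator of norm at most `1` on `𝓕(Y)`.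
Hence `g ∘ f` lies in `A` with norm at most `‖f‖_A`. Association on finite pieces together with
finite generation of `α` gives `|u(k)| ≤ ‖k‖_A α(u)` (`norm_apply_le`), so `f ⊠ id_G` has norm at
most `‖f‖_A` for every `G`.

For the converse, `G = Y^#` is universal: any Lipschitz `b : Y → M*` is the evaluation map `e : Y →
(Y^#)*` followed by the adjoint of an operator `M → Y^#`. Testing `f ⊠ id` against the single map
`e` therefore controls `u(b ∘ f)` for every `b`. By maximality only the finite pieces `Q_L ∘ δ_Y ∘
f|_Z` matter. Their target `𝓕(Y)/L` is a finite-dimensional bidual `M*`, so association turns this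
control into a bound on the ideal norm (`memMetric_of_projNorm_map_le`). -/

noncomputable section

/-! ### Duality between `X ⊠ E` and `Lip₀(X, E*)`, and extension to completions. -/

section TensorDuality

variable {𝕜 : Type*} [RCLike 𝕜] {X E : Type*} [MetricSpace X] [Zero X] [NormedAddCommGroup E]
  [NormedSpace 𝕜 E]

/-- The elementary tensors `δ_(x,y) ⊠ e` span `X ⊠ E`. -/
theorem LipTensor.induction {p : LipTensor 𝕜 X E → Prop} (u : LipTensor 𝕜 X E)
    (mk : ∀ x y e, p (LipTensor.mk 𝕜 x y e)) (zero : p 0)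
    (add : ∀ u v, p u → p v → p (u + v)) (smul : ∀ (c : 𝕜) u, p u → p (c • u)) : p u := by
  obtain ⟨u, hu⟩ := u
  induction hu using Submodule.span_induction with
  | mem φ hφ =>
    obtain ⟨x, y, e, rfl⟩ := hφ
    exact mk x y e
  | zero => exact zero
  | add a b _ _ ha hb => exact add _ _ ha hb
  | smul c a _ ha => exact smul c _ ha

/-- Two linear maps on `X ⊠ E` agree if they agree on elementary tensors. -/
theorem LipTensor.hom_ext {M : Type*} [AddCommGroup M] [Module 𝕜 M]
    {φ ψ : LipTensor 𝕜 X E →ₗ[𝕜] M}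
    (h : ∀ x y e, φ (LipTensor.mk 𝕜 x y e) = ψ (LipTensor.mk 𝕜 x y e)) : φ = ψ := by
  ext u
  induction u using LipTensor.induction with
  | mk x y e => exact h x y e
  | zero => simp
  | add u v hu hv => rw [map_add, map_add, hu, hv]
  | smul c u hu => rw [map_smul, map_smul, hu]

/-- Evaluation `u ↦ u f` at a map `f ∈ Lip₀(X, E*)`. -/
def LipTensor.evalAt (f : Lip0 X (StrongDual 𝕜 E)) : LipTensor 𝕜 X E →ₗ[𝕜] 𝕜 :=
  (Module.Dual.eval 𝕜 _ f).comp (lipTensor 𝕜 X E).subtype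

@[simp] theorem LipTensor.evalAt_apply (f : Lip0 X (StrongDual 𝕜 E)) (u : LipTensor 𝕜 X E) :
    LipTensor.evalAt f u = u.1 f := rfl

theorem LipTensor.map_coe_apply {Y F : Type*} [MetricSpace Y] [Zero Y] [NormedAddCommGroup F]
    [NormedSpace 𝕜 F] (h : Lip0 X Y) (T : E →L[𝕜] F) (u : LipTensor 𝕜 X E)
    (g : Lip0 Y (StrongDual 𝕜 F)) : (LipTensor.map h T u).1 g = u.1 (Lip0.pullback h T g) := rfl

theorem LipTensor.mk_add (x y : X) (e e' : E) :
    LipTensor.mk 𝕜 x y (e + e') = LipTensor.mk 𝕜 x y e + LipTensor.mk 𝕜 x y e' := by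
  refine Subtype.ext (LinearMap.ext fun f => ?_)
  change (LipTensor.mk 𝕜 x y (e + e')).1 f
    = (LipTensor.mk 𝕜 x y e).1 f + (LipTensor.mk 𝕜 x y e').1 f
  simp only [LipTensor.mk_coe_apply, map_add]
  ring

theorem LipTensor.mk_smul (x y : X) (c : 𝕜) (e : E) :
    LipTensor.mk 𝕜 x y (c • e) = c • LipTensor.mk 𝕜 x y e := by
  refine Subtype.ext (LinearMap.ext fun f => ?_)
  change (LipTensor.mk 𝕜 x y (c • e)).1 f = c • (LipTensor.mk 𝕜 x y e).1 f
  simp only [LipTensor.mk_coe_apply, map_smul, smul_sub]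

theorem LipTensor.mk_sub_mk (x y : X) (e : E) :
    LipTensor.mk 𝕜 x 0 e - LipTensor.mk 𝕜 y 0 e = LipTensor.mk 𝕜 x y e := by
  refine Subtype.ext (LinearMap.ext fun f => ?_)
  change (LipTensor.mk 𝕜 x 0 e).1 f - (LipTensor.mk 𝕜 y 0 e).1 f = (LipTensor.mk 𝕜 x y e).1 f
  simp only [LipTensor.mk_coe_apply]
  ring

/-- Every functional on `X ⊠ E` bounded by the projective norm is evaluation at some
`g ∈ Lip₀(X, E*)` with the same bound. -/
theorem LipTensor.exists_eq_evalAt (φ : LipTensor 𝕜 X E →ₗ[𝕜] 𝕜) {C : ℝ} (hC : 0 ≤ C)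
    (hφ : ∀ u, ‖φ u‖ ≤ C * u.projNorm) :
    ∃ g : Lip0 X (StrongDual 𝕜 E), g.lip ≤ C ∧ φ = LipTensor.evalAt g := by
  -- The only candidate for `g(x)`, since a base-point preserving `g` takes the value `g(x)(e)` on
  -- `δ_(x,0) ⊠ e`.
  let a (x : X) : StrongDual 𝕜 E := LinearMap.mkContinuous
    { toFun := fun e => φ (LipTensor.mk 𝕜 x 0 e)
      map_add' := fun e e' => by rw [LipTensor.mk_add, map_add]
      map_smul' := fun c e => by rw [LipTensor.mk_smul, map_smul]; rfl } (C * dist x 0) fun e => by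
    rw [mul_assoc, ← LipTensor.projNorm_mk (𝕜 := 𝕜)]
    exact hφ _
  have ha (x : X) (e : E) : a x e = φ (LipTensor.mk 𝕜 x 0 e) := rfl
  have hsub (x y : X) (e : E) : a x e - a y e = φ (LipTensor.mk 𝕜 x y e) := by
    rw [ha, ha, ← map_sub, LipTensor.mk_sub_mk]
  have hle (x y : X) : ‖a x - a y‖ ≤ C * dist x y :=
    ContinuousLinearMap.opNorm_le_bound _ (by positivity) fun e => by
      rw [sub_apply, hsub, mul_assoc, ← LipTensor.projNorm_mk (𝕜 := 𝕜)]
      exact hφ _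
  -- Taking `x = y = 0` in `hsub` shows that `φ` vanishes on `δ_(0,0) ⊠ e`.
  have h0 : a 0 = 0 := by
    ext e
    have := hsub 0 0 e
    rw [sub_self] at this
    rw [ha, ← this, zero_apply]
  refine ⟨Lip0.mkNorm a h0 C hC hle, Lip0.lip_le hC fun x y => ?_, LipTensor.hom_ext fun x y e => ?_⟩
  · rw [dist_eq_norm]
    exact hle x y
  · rw [LipTensor.evalAt_apply, LipTensor.mk_coe_apply, ← hsub]
    rfl

/-- The projective norm is bounded by the supremum over the unit ball of `Lip₀(X, E*)`. -/
theorem LipTensor.projNorm_le_of_forall {u : LipTensor 𝕜 X E} {C : ℝ}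
    (h : ∀ g : Lip0 X (StrongDual 𝕜 E), g.lip ≤ 1 → ‖u.1 g‖ ≤ C) : u.projNorm ≤ C := by
  let π := LipCrossNorm.proj 𝕜 X E
  -- A Hahn-Banach norming functional for `π(u)`. Asking for norm at most `1`, rather than equal to
  -- `1`, covers `u = 0`.
  obtain ⟨ψ, hψ, hψu⟩ := exists_dual_vector'' 𝕜 (LipTensorNormed.of π u)
  obtain ⟨g, hg, hgφ⟩ := LipTensor.exists_eq_evalAt
    (ψ.toLinearMap.comp (LipTensorNormed.of π).toLinearMap) zero_le_one
    fun v => (ψ.le_opNorm _).trans (mul_le_mul_of_nonneg_right hψ (norm_nonneg _))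
  have h1 : ψ (LipTensorNormed.of π u) = u.1 g := LinearMap.congr_fun hgφ u
  have h2 := h g hg
  rw [← h1, hψu, RCLike.norm_ofReal, abs_of_nonneg (norm_nonneg _)] at h2
  exact h2

/-- The infimum of the admissible constants is attained, because each inequality `|u(f)| ≤ C α(u)`
is closed in `C`. Division by `α(u)` forces the case `α(u) = 0` to be treated apart. -/
theorem LipCrossNorm.isLipBound_lipNorm (α : LipCrossNorm 𝕜 X E) {f : Lip0 X (StrongDual 𝕜 E)}
    (h : ∃ C, α.IsLipBound f C) : α.IsLipBound f (α.lipNorm f) := by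
  refine ⟨Real.sInf_nonneg fun _ hC => hC.1, fun u => ?_⟩
  rcases (apply_nonneg α.toSeminorm u).eq_or_lt with hu | hu
  · obtain ⟨C, hC⟩ := h
    simpa [← hu] using hC.2 u
  · rw [← div_le_iff₀ hu]
    refine le_csInf h fun C hC => ?_
    rw [div_le_iff₀ hu]
    exact hC.2 u

theorem LipCrossNorm.lipNorm_le (α : LipCrossNorm 𝕜 X E) {f : Lip0 X (StrongDual 𝕜 E)} {C : ℝ}
    (h : α.IsLipBound f C) : α.lipNorm f ≤ C :=
  csInf_le ⟨0, fun _ hC => hC.1⟩ h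

variable {Y F : Type*} [MetricSpace Y] [Zero Y] [NormedAddCommGroup F] [NormedSpace 𝕜 F]

/-- A bound for `h ⊠ S` yields its extension to the completions, with the same bound. -/
theorem exists_isTensorExtension {α : LipCrossNorm 𝕜 X E} {β : LipCrossNorm 𝕜 Y F} {h : Lip0 X Y}
    {S : E →L[𝕜] F} {C : ℝ} (hC : 0 ≤ C) (hb : ∀ u, β (LipTensor.map h S u) ≤ C * α u) :
    ∃ T, IsTensorExtension α β h S T ∧ ‖T‖ ≤ C := by
  let c : LipTensorNormed α →L[𝕜] LipTensorCompl α := UniformSpace.Completion.toComplL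
  let d : LipTensorNormed β →L[𝕜] LipTensorCompl β := UniformSpace.Completion.toComplL
  let φ : LipTensorNormed α →ₗ[𝕜] LipTensorCompl β :=
    d.toLinearMap.comp ((LipTensorNormed.of β).toLinearMap.comp
      ((LipTensor.map h S).comp (LipTensorNormed.of α).symm.toLinearMap))
  -- Both embeddings into the completions are isometric, so this is the assumed bound `hb`.
  have hφ (v : LipTensorNormed α) : ‖φ v‖ ≤ C * ‖c v‖ := by
    refine (UniformSpace.Completion.norm_coe _).trans_le ?_
    exact (hb ((LipTensorNormed.of α).symm v)).trans_eq
      (congrArg (C * ·) (UniformSpace.Completion.norm_coe v).symm)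
  have hc : DenseRange c := UniformSpace.Completion.denseRange_coe
  exact ⟨φ.extendOfNorm c.toLinearMap,
    fun u => LinearMap.extendOfNorm_eq hc ⟨C, hφ⟩ (LipTensorNormed.of α u),
    LinearMap.opNorm_extendOfNorm_le hc hC hφ⟩

/-- Converse of `exists_isTensorExtension`: restriction to the isometrically embedded tensor product
loses nothing. -/
theorem IsTensorExtension.le_norm {α : LipCrossNorm 𝕜 X E} {β : LipCrossNorm 𝕜 Y F} {h : Lip0 X Y}
    {S : E →L[𝕜] F} {T : LipTensorCompl α →L[𝕜] LipTensorCompl β}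
    (hT : IsTensorExtension α β h S T) (u : LipTensor 𝕜 X E) :
    β (LipTensor.map h S u) ≤ ‖T‖ * α u := by
  have h1 := T.le_opNorm (LipTensorCompl.of α u)
  rw [hT u] at h1
  exact (UniformSpace.Completion.norm_coe _).symm.trans_le
    (h1.trans_eq (congrArg (‖T‖ * ·) (UniformSpace.Completion.norm_coe _)))

end TensorDuality

/-! ### Transposes `G → Y^#` and linearization through `𝓕(Y)`. -/

section Free

variable {𝕜 : Type*} [RCLike 𝕜] {Y G : Type*} [MetricSpace Y] [Zero Y] [NormedAddCommGroup G]
  [NormedSpace 𝕜 G]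

theorem Lip0.norm_apply_sub_apply_le (g : Lip0 Y (StrongDual 𝕜 G)) (e : G) (x y : Y) :
    ‖g x e - g y e‖ ≤ g.lip * ‖e‖ * dist x y := by
  have h := (g x - g y).le_of_opNorm_le (g.norm_sub_le x y) e
  rwa [mul_right_comm]

/-- For `g ∈ Lip₀(Y, G*)` and `e ∈ G`, the function `y ↦ g(y)(e)` of `Y^#`, linearly in `e`. -/
def Lip0.transposeₗ (g : Lip0 Y (StrongDual 𝕜 G)) : G →ₗ[𝕜] LipDual 𝕜 Y where
  toFun e := Lip0.mkNorm (fun y => g y e) (by simp) (g.lip * ‖e‖)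
    (mul_nonneg g.lip_nonneg (norm_nonneg e)) (g.norm_apply_sub_apply_le e)
  map_add' e e' := Lip0.ext fun y => map_add (g y) e e'
  map_smul' c e := Lip0.ext fun y => map_smul (g y) c e

theorem Lip0.norm_transposeₗ_le (g : Lip0 Y (StrongDual 𝕜 G)) (e : G) :
    ‖g.transposeₗ e‖ ≤ g.lip * ‖e‖ :=
  Lip0.lip_le (mul_nonneg g.lip_nonneg (norm_nonneg e)) fun x y => by
    rw [dist_eq_norm]
    exact g.norm_apply_sub_apply_le e x y

/-- The continuous linear map `G → Y^#`, `e ↦ (y ↦ g(y)(e))`, for `g ∈ Lip₀(Y, G*)`. -/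
def Lip0.transpose (g : Lip0 Y (StrongDual 𝕜 G)) : G →L[𝕜] LipDual 𝕜 Y :=
  g.transposeₗ.mkContinuous g.lip g.norm_transposeₗ_le

theorem Lip0.norm_transpose_le (g : Lip0 Y (StrongDual 𝕜 G)) : ‖g.transpose‖ ≤ g.lip :=
  LinearMap.mkContinuous_norm_le _ g.lip_nonneg g.norm_transposeₗ_le

variable (𝕜 Y) in
/-- The inclusion of `𝓕(Y)` into the dual of `Y^#`. -/
def FreeSpace.incl : FreeSpace 𝕜 Y →L[𝕜] StrongDual 𝕜 (LipDual 𝕜 Y) :=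
  (freeSubmodule 𝕜 Y).subtypeL

theorem lip_freeEmb_le : (freeEmb 𝕜 Y).lip ≤ 1 :=
  Lip0.lip_le zero_le_one fun x y => by
    rw [one_mul, dist_eq_norm]
    refine ContinuousLinearMap.opNorm_le_bound _ dist_nonneg fun g => ?_
    rw [mul_comm]
    exact g.norm_sub_le x y

/-- The linear extension to `𝓕(Y)` of a Lipschitz map with values in a dual space. -/
def FreeSpace.lift (g : Lip0 Y (StrongDual 𝕜 G)) : FreeSpace 𝕜 Y →L[𝕜] StrongDual 𝕜 G :=
  (ContinuousLinearMap.precomp 𝕜 g.transpose).comp (FreeSpace.incl 𝕜 Y)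

/-- The lift is the adjoint of `g.transpose`, restricted to `𝓕(Y)`, and the transpose has norm at
most `Lip(g)`. -/
theorem FreeSpace.norm_lift_le (g : Lip0 Y (StrongDual 𝕜 G)) : ‖FreeSpace.lift g‖ ≤ g.lip := by
  refine ContinuousLinearMap.opNorm_le_bound _ g.lip_nonneg fun μ => ?_
  have h1 : ‖FreeSpace.lift g μ‖ ≤ ‖FreeSpace.incl 𝕜 Y μ‖ * ‖g.transpose‖ :=
    ContinuousLinearMap.opNorm_comp_le _ _
  calc _ ≤ ‖FreeSpace.incl 𝕜 Y μ‖ * ‖g.transpose‖ := h1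
    _ ≤ ‖μ‖ * g.lip := mul_le_mul le_rfl g.norm_transpose_le (norm_nonneg _) (norm_nonneg _)
    _ = _ := mul_comm _ _

end Free

theorem MFin.lip_incl_le {X : Type*} [MetricSpace X] [Zero X] (Z : MFin X) : Z.incl.lip ≤ 1 :=
  Lip0.lip_le zero_le_one fun x y => by rw [one_mul]; rfl

/-! ### Finite-dimensional reflexivity. -/

section DoubleDual

variable (𝕜 E : Type*) [RCLike 𝕜] [NormedAddCommGroup E] [NormedSpace 𝕜 E] [FiniteDimensional 𝕜 E]

/-- Applied twice, this makes the isometric embedding into the bidual surjective by dimension count.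
-/
theorem finrank_strongDual : Module.finrank 𝕜 (StrongDual 𝕜 E) = Module.finrank 𝕜 E :=
  (LinearMap.toContinuousLinearMap (𝕜 := 𝕜) (E := E) (F' := 𝕜)).finrank_eq.symm.trans
    Subspace.dual_finrank_eq

/-- A finite-dimensional normed space is isometric to its double dual. -/
def doubleDualEquiv : E ≃ₗᵢ[𝕜] StrongDual 𝕜 (StrongDual 𝕜 E) :=
  (NormedSpace.inclusionInDoubleDualLi 𝕜).toLinearIsometryEquiv
    (by rw [finrank_strongDual, finrank_strongDual])

end DoubleDual

/-! ### Ideal norms, finite pieces, and the two norm estimates. -/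

namespace GenericLipIdeal

variable {𝕜 : Type} [RCLike 𝕜] {A : GenericLipIdeal.{u} 𝕜} {α : GenericLipCrossNorm.{u} 𝕜}

/-- The extended norm is `⊤` off the ideal, so a finite bound already forces membership. -/
theorem extNorm_le_iff {X : Type u} [MetricSpace X] [Zero X] {E : Type u} [NormedAddCommGroup E]
    [NormedSpace 𝕜 E] [CompleteSpace E] {f : Lip0 X E} {C : ℝ} (hC : 0 ≤ C) :
    A.extNorm f ≤ ENNReal.ofReal C ↔ ∃ hf : f ∈ A.carrier X E, A.norm X E ⟨f, hf⟩ ≤ C := by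
  by_cases hf : f ∈ A.carrier X E
  · simp [extNorm, hf, ENNReal.ofReal_le_ofReal_iff hC]
  · simp [extNorm, hf]

/-- For a maximal ideal, a bound on all finite pieces of `f` is a bound on `f`. -/
theorem IsMaximal.mem_and_norm_le (hmax : A.IsMaximal) {X : Type u} [MetricSpace X] [Zero X]
    {E : Type u} [NormedAddCommGroup E] [NormedSpace 𝕜 E] [CompleteSpace E] {f : Lip0 X E} {C : ℝ}
    (hC : 0 ≤ C)
    (h : ∀ (Z : MFin X) (L : CofinSub 𝕜 E),
      ∃ hf : (Lip0.ofCLM L.proj).comp (f.comp Z.incl) ∈ A.carrier Z (E ⧸ L.carrier),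
        A.norm Z (E ⧸ L.carrier) ⟨_, hf⟩ ≤ C) :
    ∃ hf : f ∈ A.carrier X E, A.norm X E ⟨f, hf⟩ ≤ C := by
  have hle : A.maxNorm f ≤ ENNReal.ofReal C :=
    iSup_le fun Z => iSup_le fun L => (extNorm_le_iff hC).2 (h Z L)
  have hf : f ∈ A.carrier X E := (hmax X E f).1.2 (hle.trans_lt ENNReal.ofReal_lt_top)
  refine ⟨hf, ?_⟩
  rw [← (hmax X E f).2 hf] at hle
  exact (ENNReal.ofReal_le_ofReal_iff hC).1 hle

/-- Postcomposition and precomposition with maps of norm at most `C` and `1`. -/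
theorem exists_norm_comp_le {Z X : Type u} [MetricSpace Z] [Zero Z] [MetricSpace X] [Zero X]
    {E F : Type u} [NormedAddCommGroup E] [NormedSpace 𝕜 E] [CompleteSpace E]
    [NormedAddCommGroup F] [NormedSpace 𝕜 F] [CompleteSpace F] (S : E →L[𝕜] F) {f : Lip0 X E}
    (hf : f ∈ A.carrier X E) (h : Lip0 Z X) {k : Lip0 Z F} (hk : ∀ z, k z = S (f (h z)))
    (hS : ‖S‖ ≤ 1) (hh : h.lip ≤ 1) :
    ∃ hm : k ∈ A.carrier Z F, A.norm Z F ⟨k, hm⟩ ≤ A.norm X E ⟨f, hf⟩ := by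
  -- Describing `k` pointwise lets it be supplied as a pullback or as a composite bracketed
  -- differently.
  obtain rfl : k = (Lip0.ofCLM S).comp (f.comp h) := Lip0.ext hk
  have h0 : 0 ≤ A.norm X E ⟨f, hf⟩ := apply_nonneg _ _
  refine ⟨A.comp_mem Z X E F S ⟨f, hf⟩ h, (A.norm_comp_le Z X E F S ⟨f, hf⟩ h).trans ?_⟩
  calc _ ≤ 1 * A.norm X E ⟨f, hf⟩ * 1 := by
        refine mul_le_mul (mul_le_mul_of_nonneg_right hS h0) hh h.lip_nonneg (by rwa [one_mul])
    _ = _ := by ring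

/-- If `α` is finitely generated and associated to `A`, then `|u(f)| ≤ ‖f‖_A α(u)`. -/
theorem norm_apply_le (hfg : α.FinitelyGenerated) (hassoc : A.IsAssociated α) {X : Type u}
    [MetricSpace X] [Zero X] {E : Type u} [NormedAddCommGroup E] [NormedSpace 𝕜 E]
    [CompleteSpace E] {f : Lip0 X (StrongDual 𝕜 E)} (hf : f ∈ A.carrier X (StrongDual 𝕜 E))
    (u : LipTensor 𝕜 X E) :
    ‖u.1 f‖ ≤ A.norm X (StrongDual 𝕜 E) ⟨f, hf⟩ * α.norm X E u := by
  set s := {r : ℝ | ∃ (X₀ : MFin X) (E₀ : FinSub 𝕜 E) (u₀ : LipTensor 𝕜 X₀ E₀),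
      LipTensor.map X₀.incl E₀.carrier.subtypeL u₀ = u ∧ r = α.norm X₀ E₀ u₀}
  have hs : α.norm X E u = sInf s := hfg X E u
  have h0 : 0 ≤ A.norm X (StrongDual 𝕜 E) ⟨f, hf⟩ := apply_nonneg _ _
  have key : ∀ r ∈ s, ‖u.1 f‖ ≤ A.norm X (StrongDual 𝕜 E) ⟨f, hf⟩ * r := by
    rintro r ⟨X₀, E₀, u₀, rfl, rfl⟩
    -- The pulled-back map restricts `f` to `X₀` and each functional `f(x)` to `E₀`. The first is
    -- precomposition with the inclusion, the second postcomposition with its adjoint `E* → E₀*`,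
    -- both of norm at most `1`.
    obtain ⟨hm, hle⟩ := exists_norm_comp_le
      (ContinuousLinearMap.precomp 𝕜 E₀.carrier.subtypeL) hf X₀.incl
      (k := Lip0.pullback X₀.incl E₀.carrier.subtypeL f) (fun z => rfl)
      (ContinuousLinearMap.opNorm_le_bound _ zero_le_one fun φ => by
        rw [one_mul]
        refine (ContinuousLinearMap.opNorm_comp_le _ _).trans ?_
        exact mul_le_of_le_one_right (norm_nonneg _) (Submodule.norm_subtypeL_le _))
      X₀.lip_incl_le
    have h1 := (hassoc X₀ E₀ (Lip0.pullback X₀.incl E₀.carrier.subtypeL f))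
    have h2 := ((α.norm X₀ E₀).isLipBound_lipNorm (h1.1.1 hm)).2 u₀
    rw [← h1.2 hm] at h2
    rw [LipTensor.map_coe_apply]
    exact h2.trans (mul_le_mul_of_nonneg_right hle (apply_nonneg _ _))
  -- If `s` is empty, the real infimum takes its default value `0`, whence `α(u) = 0` and `u = 0`.
  rcases s.eq_empty_or_nonempty with he | hne
  · rw [he, Real.sInf_empty] at hs
    rw [(α.norm X E).eq_zero' u hs]
    simp
  · rcases h0.eq_or_lt with h | h
    · obtain ⟨r, hr⟩ := hne
      simpa only [← h, zero_mul] using key r hr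
    · rw [hs, ← div_le_iff₀' h]
      refine le_csInf hne fun r hr => ?_
      rw [div_le_iff₀' h]
      exact key r hr

variable {X Y : Type u} [MetricSpace X] [Zero X] [MetricSpace Y] [Zero Y] {f : Lip0 X Y}

/-- By duality it suffices to bound `u(g ∘ f)` for `Lip(g) ≤ 1`. Since `g ∘ f` is `FreeSpace.lift g`
after `δ_Y ∘ f`, the linear ideal property bounds its norm by `‖f‖_A`, and `norm_apply_le`
concludes. -/
theorem projNorm_map_le (hfg : α.FinitelyGenerated) (hassoc : A.IsAssociated α)
    (hf : A.MemMetric f) {G : Type u} [NormedAddCommGroup G] [NormedSpace 𝕜 G] [CompleteSpace G]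
    (u : LipTensor 𝕜 X G) :
    (LipTensor.map f (ContinuousLinearMap.id 𝕜 G) u).projNorm
      ≤ A.metricNorm f hf * α.norm X G u := by
  refine LipTensor.projNorm_le_of_forall fun g hg => ?_
  obtain ⟨hm, hle⟩ := exists_norm_comp_le (FreeSpace.lift g) hf
    ⟨id, rfl, 1, zero_le_one, fun x y => by simp⟩
    (k := Lip0.pullback f (ContinuousLinearMap.id 𝕜 G) g) (fun _ => rfl)
    ((FreeSpace.norm_lift_le g).trans hg) (Lip0.lip_le zero_le_one fun x y => by simp)
  rw [LipTensor.map_coe_apply]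
  exact (norm_apply_le hfg hassoc hm u).trans (mul_le_mul_of_nonneg_right hle (apply_nonneg _ _))

/-- Each finite piece of `δ_Y ∘ f` defines a functional that factors through `f ⊠ id_{Y^#}`, so it
inherits the bound `C`; association and maximality then give the bound on `f`. -/
theorem memMetric_of_projNorm_map_le (hmax : A.IsMaximal) (hassoc : A.IsAssociated α) {C : ℝ}
    (hC : 0 ≤ C)
    (h : ∀ u : LipTensor 𝕜 X (LipDual 𝕜 Y),
      (LipTensor.map f (ContinuousLinearMap.id 𝕜 (LipDual 𝕜 Y)) u).projNorm
        ≤ C * α.norm X (LipDual 𝕜 Y) u) :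
    ∃ hf : A.MemMetric f, A.metricNorm f hf ≤ C := by
  refine hmax.mem_and_norm_le hC fun Z L => ?_
  -- Association concerns only maps into dual spaces, so the quotient is replaced by its bidual
  -- `M*`.
  let M := StrongDual 𝕜 (FreeSpace 𝕜 Y ⧸ L.carrier)
  let q : Lip0 Y (FreeSpace 𝕜 Y ⧸ L.carrier) := (Lip0.ofCLM L.proj).comp (freeEmb 𝕜 Y)
  let κ := doubleDualEquiv 𝕜 (FreeSpace 𝕜 Y ⧸ L.carrier)
  let b : Lip0 Y (StrongDual 𝕜 M) := (Lip0.ofCLM (𝕜 := 𝕜) κ.toLinearIsometry.toContinuousLinearMap).comp q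
  have hb : b.lip ≤ 1 := Lip0.lip_le zero_le_one fun x y => by
    have h1 : b x - b y = κ (L.proj (freeEmb 𝕜 Y x - freeEmb 𝕜 Y y)) := by
      rw [map_sub, κ.map_sub]; rfl
    rw [dist_eq_norm, h1, κ.norm_map]
    refine (Submodule.Quotient.norm_mk_le L.carrier _).trans
      (((freeEmb 𝕜 Y).norm_sub_le x y).trans ?_)
    exact mul_le_mul_of_nonneg_right lip_freeEmb_le dist_nonneg
  -- The evaluation map `y ↦ (g ↦ g(y))`, the one test map needed on `Y ⊠ Y^#`.
  let e : Lip0 Y (StrongDual 𝕜 (LipDual 𝕜 Y)) :=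
    (Lip0.ofCLM (FreeSpace.incl 𝕜 Y)).comp (freeEmb 𝕜 Y)
  have he : e.lip ≤ 1 := lip_freeEmb_le (𝕜 := 𝕜) (Y := Y)
  let k : Lip0 Z (StrongDual 𝕜 M) := b.comp (f.comp Z.incl)
  have hk : (α.norm Z M).IsLipBound k C := by
    refine ⟨hC, fun u => ?_⟩
    -- On `δ_(x,y) ⊠ φ` both sides equal `b(f x)(φ) - b(f y)(φ)`, because `b.transpose φ` evaluated
    -- at a point of `Y` is `b` there applied to `φ`.
    have h1 : LipTensor.evalAt k = (LipTensor.evalAt e).comp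
        ((LipTensor.map f (ContinuousLinearMap.id 𝕜 (LipDual 𝕜 Y))).comp
          (LipTensor.map Z.incl b.transpose)) := by
      refine LipTensor.hom_ext fun x y φ => ?_
      simp only [LinearMap.comp_apply, LipTensor.map_mk, LipTensor.evalAt_apply,
        LipTensor.mk_coe_apply]
      rfl
    have h2 : u.1 k = (LipTensor.map f (ContinuousLinearMap.id 𝕜 (LipDual 𝕜 Y))
        (LipTensor.map Z.incl b.transpose u)).1 e := LinearMap.congr_fun h1 u
    rw [h2]
    calc _ ≤ e.lip * _ := LipTensor.norm_apply_le_projNorm _ _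
      _ ≤ 1 * _ := mul_le_mul_of_nonneg_right he (LipTensor.projNorm_nonneg _)
      _ = _ := one_mul _
      _ ≤ C * α.norm X (LipDual 𝕜 Y) (LipTensor.map Z.incl b.transpose u) := h _
      _ ≤ C * (1 * α.norm Z M u) := by
        refine mul_le_mul_of_nonneg_left
          ((α.metric_mapping Z X M (LipDual 𝕜 Y) Z.incl b.transpose u).trans ?_) hC
        refine mul_le_mul_of_nonneg_right ?_ (apply_nonneg _ _)
        exact mul_le_one₀ Z.lip_incl_le (norm_nonneg _) (b.norm_transpose_le.trans hb)
      _ = _ := by rw [one_mul]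
  have hmem : k ∈ A.carrier Z (StrongDual 𝕜 M) := (hassoc Z M k).1.2 ⟨C, hk⟩
  have hnorm : A.norm Z (StrongDual 𝕜 M) ⟨k, hmem⟩ ≤ C :=
    ((hassoc Z M k).2 hmem).trans_le ((α.norm Z M).lipNorm_le hk)
  -- Return from the bidual to the quotient by the inverse isometry, without increasing the norm.
  obtain ⟨hm, hle⟩ := exists_norm_comp_le κ.symm.toLinearIsometry.toContinuousLinearMap hmem
    ⟨id, rfl, 1, zero_le_one, fun x y => by simp⟩
    (k := (Lip0.ofCLM L.proj).comp (((freeEmb 𝕜 Y).comp f).comp Z.incl))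
    (fun z => (κ.symm_apply_apply _).symm)
    (ContinuousLinearMap.opNorm_le_bound _ zero_le_one fun φ => by
      rw [one_mul]; exact (κ.symm.norm_map φ).le)
    (Lip0.lip_le zero_le_one fun x y => by simp)
  exact ⟨hm, hle.trans hnorm⟩

end GenericLipIdeal

end

theorem mainTheorem5 {𝕜 : Type} [RCLike 𝕜]
    (A : GenericLipIdeal.{u} 𝕜) (hstrong : A.IsStrong) (hmax : A.IsMaximal)
    (α : GenericLipCrossNorm.{u} 𝕜) (hfg : α.FinitelyGenerated) (hassoc : A.IsAssociated α)
    (X Y : Type u) [MetricSpace X] [Zero X] [MetricSpace Y] [Zero Y] (f : Lip0 X Y) :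
    (A.MemMetric f ↔
      ∀ (G : Type u) [NormedAddCommGroup G] [NormedSpace 𝕜 G] [CompleteSpace G],
        ∃ T, IsTensorExtension (α.norm X G) (LipCrossNorm.proj 𝕜 Y G) f
          (ContinuousLinearMap.id 𝕜 G) T) ∧
    (A.MemMetric f ↔
      ∃ T, IsTensorExtension (α.norm X (LipDual 𝕜 Y)) (LipCrossNorm.proj 𝕜 Y (LipDual 𝕜 Y)) f
        (ContinuousLinearMap.id 𝕜 (LipDual 𝕜 Y)) T) ∧
    (∀ hf : A.MemMetric f,
      ∃ T, IsTensorExtension (α.norm X (LipDual 𝕜 Y)) (LipCrossNorm.proj 𝕜 Y (LipDual 𝕜 Y)) f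
          (ContinuousLinearMap.id 𝕜 (LipDual 𝕜 Y)) T ∧
        A.metricNorm f hf = ‖T‖ ∧
        ∀ (G : Type u) [NormedAddCommGroup G] [NormedSpace 𝕜 G] [CompleteSpace G],
          ∃ T', IsTensorExtension (α.norm X G) (LipCrossNorm.proj 𝕜 Y G) f
              (ContinuousLinearMap.id 𝕜 G) T' ∧ ‖T'‖ ≤ ‖T‖) := by
  have ext (hf : A.MemMetric f) (G : Type u) [NormedAddCommGroup G] [NormedSpace 𝕜 G]
      [CompleteSpace G] : ∃ T, IsTensorExtension (α.norm X G) (LipCrossNorm.proj 𝕜 Y G) f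
        (ContinuousLinearMap.id 𝕜 G) T ∧ ‖T‖ ≤ A.metricNorm f hf :=
    exists_isTensorExtension (apply_nonneg _ _)
      (GenericLipIdeal.projNorm_map_le hfg hassoc hf)
  have mem {T} (hT : IsTensorExtension (α.norm X (LipDual 𝕜 Y))
      (LipCrossNorm.proj 𝕜 Y (LipDual 𝕜 Y)) f (ContinuousLinearMap.id 𝕜 (LipDual 𝕜 Y)) T) :
      ∃ hf : A.MemMetric f, A.metricNorm f hf ≤ ‖T‖ :=
    GenericLipIdeal.memMetric_of_projNorm_map_le hmax hassoc (norm_nonneg T) hT.le_norm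
  refine ⟨⟨fun hf G _ _ _ => ?_, fun h => ?_⟩, ⟨fun hf => ?_, fun ⟨T, hT⟩ => (mem hT).1⟩,
    fun hf => ?_⟩
  · obtain ⟨T, hT, -⟩ := ext hf G
    exact ⟨T, hT⟩
  · obtain ⟨T, hT⟩ := h (LipDual 𝕜 Y)
    exact (mem hT).1
  · obtain ⟨T, hT, -⟩ := ext hf (LipDual 𝕜 Y)
    exact ⟨T, hT⟩
  · obtain ⟨T, hT, hle⟩ := ext hf (LipDual 𝕜 Y)
    -- The two estimates have matching constants: `T` itself supplies the constant `‖T‖` for the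
    -- converse.
    have heq : A.metricNorm f hf = ‖T‖ := le_antisymm (mem hT).2 hle
    refine ⟨T, hT, heq, fun G _ _ _ => ?_⟩
    rw [← heq]
    exact ext hf G
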